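/- Let $G$ be a group generated by $x_1,\dots,x_d$, let $F_d$ be the free group on $X_1,\dots,X_d$, let $\phi:F_d\to G$ be the homomorphism with $\phi(X_i)=x_i$, and let $N=\ker\phi$. Let $\mathrm{Cal}(G)$ be the right Cayley graph, regarded as a one-dimensional topological complex: its vertices are the elements of $G$, and for every $g\in G$ and every $i\in\{1,\dots,d\}$ there is one edge (a copy of $[0,1]$) from $g$ to $gx_i$. The group $G$ acts on $\mathrm{Cal}(G)$ by left translations. Let $\pi_1(\mathrm{Cal}(G),e)$ be the fundamental group based at the vertex $e$, the product of two classes being the class of the first loop followed by the second. The free group $F_d$ acts on $\pi_1(\mathrm{Cal}(G),e)$ from the left by the action in which the generator $X_i$ sends the class of a loop $\lambda$ to the class of the loop that first goes along the edge from $e$ to $x_i$, then passes the translate $x_i\lambda$, and then goes back along the same edge. For $a\in N$ let $\bar\gamma(a)\in\pi_1(\mathrm{Cal}(G),e)$ be the homotopy class of the loop that starts at $e$ and passes successively the edges corresponding to the letters of the reduced word of $a$, where a letter $X_i$ leads from $g$ to $gx_i$ along the edge $(g,i)$, and a letter $X_i^{-1}$ leads from $g$ to $gx_i^{-1}$ along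 the edge $(gx_i^{-1},i)$ in the negative direction. Then $\bar\gamma:N\to\pi_1(\mathrm{Cal}(G),e)$ is an isomorphism of groups, and it is $F_d$-equivariant: $$\bar\gamma(waw^{-1})=w(\bar\gamma(a))\qquad\text{for all } w\in F_d,\ a\in N.$$ -/

import Mathlib

noncomputable section

namespace CayleyComplex

variable {G : Type*} [Group G] {d : ℕ}

/-- The disjoint union of the cells: a point for every vertex `g : G`, and a copy of the unit
interval for every `g : G` and every generator index `i` (both families carry the topology
of a disjoint union). -/
abbrev Cells (G : Type*) (d : ℕ) : Type _ :=
  (Σ _ : G, Unit) ⊕ (Σ _ : G × Fin d, unitInterval)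

/-- The identifications: the edge `(g, i)` starts at the vertex `g` and ends at the vertex
`g * x i`. In particular all the starting points `(g, i, 0)` with the same `g` are identified. -/
inductive Glue (x : Fin d → G) : Cells G d → Cells G d → Prop
  | source (g : G) (i : Fin d) : Glue x (Sum.inr ⟨(g, i), 0⟩) (Sum.inl ⟨g, ()⟩)
  | target (g : G) (i : Fin d) : Glue x (Sum.inr ⟨(g, i), 1⟩) (Sum.inl ⟨g * x i, ()⟩)

/-- The right Cayley graph of `G` with respect to the family `x`, as a one-dimensional topological
complex, with the quotient topology. The vertices are listed explicitly as cells; for `d > 0`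
this is the quotient of `G × {1, …, d} × [0,1]` alone, and for `d = 0` it gives a point (and not
the empty space) as the Cayley graph of the trivial group. -/
def Cal (x : Fin d → G) : Type _ := Quot (Glue x)

instance (x : Fin d → G) : TopologicalSpace (Cal x) :=
  inferInstanceAs (TopologicalSpace (Quot (Glue x)))

/-- The vertex `g` of the Cayley graph. -/
def vertex (x : Fin d → G) (g : G) : Cal x := Quot.mk _ (Sum.inl ⟨g, ()⟩)

/-- The edge `(g, i)` of the Cayley graph, as a path from the vertex `g` to `g * x i`. -/
def edge (x : Fin d → G) (g : G) (i : Fin d) : Path (vertex x g) (vertex x (g * x i)) where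
  toFun t := Quot.mk _ (Sum.inr ⟨(g, i), t⟩)
  continuous_toFun := continuous_quot_mk.comp (continuous_inr.comp continuous_sigmaMk)
  source' := Quot.sound (Glue.source g i)
  target' := Quot.sound (Glue.target g i)

/-- Left translation by `h` on the cells. -/
def shiftCells (h : G) : Cells G d → Cells G d :=
  Sum.map (Sigma.map (fun g => h * g) fun _ => id)
    (Sigma.map (fun e => (h * e.1, e.2)) fun _ => id)

/-- The left action of `h : G` on the Cayley graph: it maps the vertex `g` to the vertex `h * g`,
and the edge `(g, i)` to the edge `(h * g, i)`. -/
def shift (x : Fin d → G) (h : G) : C(Cal x, Cal x) where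
  toFun := Quot.map (shiftCells h) (by
    rintro _ _ (⟨g, i⟩ | ⟨g, i⟩)
    · exact Glue.source (h * g) i
    · have := Glue.target (x := x) (h * g) i
      rw [mul_assoc] at this
      exact this)
  continuous_toFun := by
    refine continuous_quot_lift _ (continuous_quot_mk.comp ?_)
    refine Continuous.sumMap ?_ ?_
    · exact continuous_sigma fun g => continuous_sigmaMk (σ := fun _ : G => Unit) (i := h * g)
    · exact continuous_sigma fun e =>
        continuous_sigmaMk (σ := fun _ : G × Fin d => unitInterval) (i := (h * e.1, e.2))

theorem shift_vertex (x : Fin d → G) (h g : G) : shift x h (vertex x g) = vertex x (h * g) := rfl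

theorem shift_shift (x : Fin d → G) (h k : G) (p : Cal x) :
    shift x h (shift x k p) = shift x (h * k) p := by
  obtain ⟨(⟨g, _⟩ | ⟨⟨g, i⟩, t⟩)⟩ := p
  · exact congrArg (vertex x) (mul_assoc h k g).symm
  · exact congrArg (fun g' => (Quot.mk _ (Sum.inr ⟨(g', i), t⟩) : Cal x)) (mul_assoc h k g).symm

theorem shift_one (x : Fin d → G) (p : Cal x) : shift x 1 p = p := by
  obtain ⟨(⟨g, _⟩ | ⟨⟨g, i⟩, t⟩)⟩ := p
  · exact congrArg (vertex x) (one_mul g)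
  · exact congrArg (fun g' => (Quot.mk _ (Sum.inr ⟨(g', i), t⟩) : Cal x)) (one_mul g)

/-! ### Paths spelled by words -/

/-- The path from the vertex `g` along the letter `(i, true)`, which stands for the `i`-th
generator, or `(i, false)`, which stands for its inverse (then the edge that ends at `g` is passed
in the negative direction). -/
def letterPath (x : Fin d → G) (g : G) :
    (l : Fin d × Bool) → Path (vertex x g) (vertex x (g * FreeGroup.lift x (FreeGroup.mk [l])))
  | (i, true) => (edge x g i).cast rfl (by simp)
  | (i, false) => (edge x (g * (x i)⁻¹) i).symm.cast (by simp) (by simp)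

/-- The edge path that starts at the vertex `g` and is spelled by a word. -/
def wordPath (x : Fin d → G) : (g : G) → (L : List (Fin d × Bool)) →
    Path (vertex x g) (vertex x (g * FreeGroup.lift x (FreeGroup.mk L)))
  | g, [] => (Path.refl (vertex x g)).cast rfl (by simp)
  | g, l :: L => ((letterPath x g l).trans (wordPath x _ L)).cast rfl (by simp [mul_assoc])

/-- The path from the identity vertex spelled by the reduced word of `w`; it ends at the image
of `w` in `G`. -/
def gamma (x : Fin d → G) (w : FreeGroup (Fin d)) :
    Path (vertex x 1) (vertex x (FreeGroup.lift x w)) :=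
  (wordPath x 1 w.toWord).cast rfl (by rw [one_mul, FreeGroup.mk_toWord])

/-! ### The fundamental group and the action of the free group on it -/

/-- The fundamental group of the Cayley graph with the identity vertex as its basepoint, where the
product of two classes is the class of the first loop followed by the second one. (Mathlib's
`FundamentalGroup` is composed in the order of endomorphisms, so the opposite is taken.) -/
abbrev PiOne (x : Fin d → G) : Type _ := (FundamentalGroup (Cal x) (vertex x 1))ᵐᵒᵖ

/-- The homotopy class of a loop. -/
def ofLoop (x : Fin d → G) (p : Path.Homotopic.Quotient (vertex x 1) (vertex x 1)) : PiOne x :=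
  MulOpposite.op (FundamentalGroup.fromPath p)

/-- The underlying homotopy class of an element of the fundamental group. -/
def toLoop {x : Fin d → G} (p : PiOne x) : Path.Homotopic.Quotient (vertex x 1) (vertex x 1) :=
  FundamentalGroup.toPath p.unop

theorem ofLoop_mul (x : Fin d → G) (p q : Path.Homotopic.Quotient (vertex x 1) (vertex x 1)) :
    ofLoop x p * ofLoop x q = ofLoop x (p.trans q) := rfl

/-- The map that sends an element `a` of the kernel of `F_d → G` to the homotopy class of the
loop spelled by `a`. -/
def gammaBar (x : Fin d → G) (a : (FreeGroup.lift x).ker) : PiOne x :=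
  ofLoop x (Path.Homotopic.Quotient.mk
    ((gamma x a).cast rfl (by rw [(FreeGroup.lift x).mem_ker.1 a.2])))

/-- The result of applying the generator `X_i` to the class of a loop `l`: the class of the loop
that first goes along the edge from the identity vertex to the vertex `x i`, then passes `l` shifted
to this vertex, and then goes back along the same edge. -/
def genLoop (x : Fin d → G) (i : Fin d)
    (l : Path.Homotopic.Quotient (vertex x 1) (vertex x 1)) :
    Path.Homotopic.Quotient (vertex x 1) (vertex x 1) :=
  let e : Path.Homotopic.Quotient (vertex x 1) (vertex x (x i)) :=
    .mk ((edge x 1 i).cast rfl (by rw [one_mul]))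
  let l' : Path.Homotopic.Quotient (vertex x (x i)) (vertex x (x i)) :=
    (l.map (shift x (x i))).cast (by rw [shift_vertex, mul_one]) (by rw [shift_vertex, mul_one])
  (e.trans l').trans e.symm

theorem map_shift_shift (x : Fin d → G) (h k : G) (hk : h * k = 1) {a b : Cal x}
    (p : Path.Homotopic.Quotient a b) :
    (p.map (shift x k)).map (shift x h) =
      p.cast (by rw [shift_shift, hk, shift_one]) (by rw [shift_shift, hk, shift_one]) := by
  induction p using Path.Homotopic.Quotient.ind with | mk p =>
  refine congrArg Path.Homotopic.Quotient.mk (Path.ext (funext fun t => ?_))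
  change shift x h (shift x k (p t)) = p t
  rw [shift_shift, hk, shift_one]

theorem genLoop_bijective (x : Fin d → G) (i : Fin d) : Function.Bijective (genLoop x i) := by
  constructor
  · intro l m hlm
    have h0 := congrArg (fun q => (Path.Homotopic.Quotient.symm
      (.mk ((edge x 1 i).cast rfl (by rw [one_mul])) :
        Path.Homotopic.Quotient (vertex x 1) (vertex x (x i)))).trans
      (q.trans (.mk ((edge x 1 i).cast rfl (by rw [one_mul]))))) hlm
    simp only [genLoop, Path.Homotopic.Quotient.trans_assoc, Path.Homotopic.Quotient.symm_trans,
      Path.Homotopic.Quotient.trans_refl] at h0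
    simp only [← Path.Homotopic.Quotient.trans_assoc, Path.Homotopic.Quotient.symm_trans,
      Path.Homotopic.Quotient.refl_trans] at h0
    have h1 := congrArg (fun q => (Path.Homotopic.Quotient.map q (shift x (x i)⁻¹)).cast
      (x' := vertex x 1) (y' := vertex x 1)
      (by rw [shift_vertex, inv_mul_cancel]) (by rw [shift_vertex, inv_mul_cancel])) h0
    simpa only [Path.Homotopic.Quotient.map_cast, Path.Homotopic.Quotient.cast_cast,
      map_shift_shift x _ _ (inv_mul_cancel (x i)), Path.Homotopic.Quotient.cast_rfl_rfl] using h1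
  · intro m
    let e : Path.Homotopic.Quotient (vertex x 1) (vertex x (x i)) :=
      .mk ((edge x 1 i).cast rfl (by rw [one_mul]))
    refine ⟨(((e.symm.trans m).trans e).map (shift x (x i)⁻¹)).cast
      (by rw [shift_vertex, inv_mul_cancel]) (by rw [shift_vertex, inv_mul_cancel]), ?_⟩
    change (e.trans _).trans e.symm = m
    simp only [Path.Homotopic.Quotient.map_cast, Path.Homotopic.Quotient.cast_cast,
      map_shift_shift x _ _ (mul_inv_cancel (x i)), Path.Homotopic.Quotient.cast_rfl_rfl,
      Path.Homotopic.Quotient.trans_assoc, Path.Homotopic.Quotient.trans_symm,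
      Path.Homotopic.Quotient.trans_refl]
    simp only [← Path.Homotopic.Quotient.trans_assoc, Path.Homotopic.Quotient.trans_symm,
      Path.Homotopic.Quotient.refl_trans]

theorem genLoop_trans (x : Fin d → G) (i : Fin d)
    (l m : Path.Homotopic.Quotient (vertex x 1) (vertex x 1)) :
    genLoop x i (l.trans m) = (genLoop x i l).trans (genLoop x i m) := by
  have key : ∀ {a b : Cal x} (f : C(Cal x, Cal x)) (h : b = f a)
      (l m : Path.Homotopic.Quotient a a), ((l.trans m).map f).cast h h =
        ((l.map f).cast h h).trans ((m.map f).cast h h) := by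
    rintro a _ f rfl l m
    induction l using Path.Homotopic.Quotient.ind with | mk l =>
    induction m using Path.Homotopic.Quotient.ind with | mk m =>
    exact congrArg Path.Homotopic.Quotient.mk (Path.map_trans l m f.continuous)
  have cancel : ∀ {a b : Cal x} (e : Path.Homotopic.Quotient a b)
      (p q : Path.Homotopic.Quotient b b), (e.trans (p.trans q)).trans e.symm =
        ((e.trans p).trans e.symm).trans ((e.trans q).trans e.symm) := by
    intro a b e p q
    simp only [Path.Homotopic.Quotient.trans_assoc]
    rw [← Path.Homotopic.Quotient.trans_assoc e.symm e, Path.Homotopic.Quotient.symm_trans,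
      Path.Homotopic.Quotient.refl_trans]
  simp only [genLoop]
  rw [key, cancel]

/-- The action of the generator `X_i` on the fundamental group, as a group automorphism. -/
def genAut (x : Fin d → G) (i : Fin d) : MulAut (PiOne x) :=
  MulEquiv.ofBijective
    (MonoidHom.mk' (fun p => ofLoop x (genLoop x i (toLoop p)))
      fun p q => congrArg (ofLoop x) (genLoop_trans x i (toLoop p) (toLoop q)))
    ⟨fun _ _ h => MulOpposite.unop_injective
        ((genLoop_bijective x i).1 (MulOpposite.op_injective h)),
      fun q => (genLoop_bijective x i).2 (toLoop q) |>.elim fun l hl =>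
        ⟨ofLoop x l, congrArg (ofLoop x) hl⟩⟩

/-- The left action of the free group on the fundamental group of the Cayley graph, determined by
the action of the generators. -/
def action (x : Fin d → G) : FreeGroup (Fin d) →* MulAut (PiOne x) :=
  FreeGroup.lift (genAut x)

end CayleyComplex

end

/-!
The free group acts on the right on the classes of paths from the vertex `1` to an arbitrary
vertex: the generator `X_i` appends the edge with the label `i`, which is an invertible operation.
By induction on words, acting with `w` on the constant path gives the path `gamma w` spelled by the
reduced word of `w` (`append_refl`), so that the invariance of spelled paths under free reduction is
contained in the fact that this is an action. Appending edges commutes with prepending a loop, which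
shows that `gammaBar` is multiplicative (`gammaBar_mul`). Left translation by `x i` maps spelled
paths to spelled paths, hence conjugating the translate of `gammaBar a` by the edge from `1` to
`x i` appends the letters of `X_i * a * X_i⁻¹`; this gives the equivariance for generators
(`genLoop_gammaBar`), and then for all words (`gammaBar_conj`).

Injectivity (`gammaHom_injective`): the Cayley graph of `G` is the quotient of the Cayley graph of
the free group by the free action of the kernel, and the projection is a covering map
(`isQuotientCoveringMap_proj`). The loop spelled by `a` lifts to a path from `1` to `a`, so if it is
null-homotopic, then `a = 1`.

Surjectivity (`gammaHom_surjective`): every loop is homotopic to its image under the map `collapse`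
that shrinks the star of radius `1 / 3` around each vertex to this vertex. By compactness, the
interval can be subdivided so that the original loop maps every piece into one such star or into
the interior of one edge; the collapsed loop is then constant or runs inside one edge on each piece.
Appending such a piece preserves the property of being spelled by a word up to a segment of an edge
(`IsTame.trans_subpath`), and at the end the loop is back at a vertex.
-/

noncomputable section

namespace CayleyComplex

variable {G : Type*} [Group G] {d : ℕ}

open Path

/-! ### The action of the free group on classes of paths -/

/-- Homotopy classes of paths from the identity vertex to an arbitrary vertex. -/
abbrev VertexClass (x : Fin d → G) : Type _ := Σ g : G, Homotopic.Quotient (vertex x 1) (vertex x g)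

theorem VertexClass.ext_cast {x : Fin d → G} {g h : G}
    {p : Homotopic.Quotient (vertex x 1) (vertex x g)}
    {q : Homotopic.Quotient (vertex x 1) (vertex x h)} (e : g = h)
    (hp : p = q.cast rfl (by rw [e])) :
    (⟨g, p⟩ : VertexClass x) = ⟨h, q⟩ := by
  subst e
  simpa using hp

theorem trans_cast {X : Type*} [TopologicalSpace X] {a b c c' : X} (p : Homotopic.Quotient a b)
    (q : Homotopic.Quotient b c) (h : c' = c) :
    p.trans (q.cast rfl h) = (p.trans q).cast rfl h := by
  subst h
  simp

theorem cast_trans_cast {X : Type*} [TopologicalSpace X] {a b b' c c' : X}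
    (p : Homotopic.Quotient a b) (q : Homotopic.Quotient b c) (h : b' = b) (h' : c' = c) :
    (p.cast rfl h).trans (q.cast h h') = (p.trans q).cast rfl h' := by
  subst h h'
  simp

theorem trans_symm_cast_trans {X : Type*} [TopologicalSpace X] {a b b' c : X}
    (p : Homotopic.Quotient a b) (q : Homotopic.Quotient c b') (h : b = b') :
    (p.trans (q.symm.cast h rfl)).trans q = p.cast rfl h.symm := by
  subst h
  simp [Homotopic.Quotient.trans_assoc]

/-- Appending the edge with the label `i` at the end of a path, as a permutation of the classes of
paths from the identity vertex to a vertex. -/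
def appendEdge (x : Fin d → G) (i : Fin d) : Equiv.Perm (VertexClass x) where
  toFun y := ⟨y.1 * x i, y.2.trans (.mk (edge x y.1 i))⟩
  invFun y := ⟨y.1 * (x i)⁻¹,
    y.2.trans ((Homotopic.Quotient.mk (edge x (y.1 * (x i)⁻¹) i)).symm.cast (by simp) rfl)⟩
  left_inv := by
    rintro ⟨g, p⟩
    refine VertexClass.ext_cast (by simp) ?_
    have key : ∀ (h : G) (e : h = g) (h' : vertex x (g * x i) = vertex x (h * x i)),
        (p.trans (Homotopic.Quotient.mk (edge x g i))).trans
          ((Homotopic.Quotient.mk (edge x h i)).symm.cast h' rfl) =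
            p.cast rfl (congrArg (vertex x) e) := by
      rintro h rfl h'
      simp [Homotopic.Quotient.trans_assoc]
    exact key _ (by simp) _
  right_inv := by
    rintro ⟨g, p⟩
    refine VertexClass.ext_cast (by simp) ?_
    exact trans_symm_cast_trans _ _ _

/-- The right action of the free group on the classes of paths from the identity vertex to a vertex
(a homomorphism to the opposite of the group of permutations): `X_i` appends the edge with the
label `i`. -/
def append (x : Fin d → G) : FreeGroup (Fin d) →* (Equiv.Perm (VertexClass x))ᵐᵒᵖ :=
  FreeGroup.lift fun i => MulOpposite.op (appendEdge x i)

theorem append_mul (x : Fin d → G) (v w : FreeGroup (Fin d)) (y : VertexClass x) :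
    (append x (v * w)).unop y = (append x w).unop ((append x v).unop y) := by
  rw [map_mul]; rfl

theorem append_one (x : Fin d → G) (y : VertexClass x) : (append x 1).unop y = y := by
  rw [map_one]; rfl

theorem append_of (x : Fin d → G) (i : Fin d) (y : VertexClass x) :
    (append x (FreeGroup.of i)).unop y = ⟨y.1 * x i, y.2.trans (.mk (edge x y.1 i))⟩ := by
  simp [append]; rfl

theorem append_letter (x : Fin d → G) (l : Fin d × Bool) (g : G)
    (p : Homotopic.Quotient (vertex x 1) (vertex x g)) :
    (append x (FreeGroup.mk [l])).unop ⟨g, p⟩ =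
      ⟨g * FreeGroup.lift x (FreeGroup.mk [l]), p.trans (.mk (letterPath x g l))⟩ := by
  obtain ⟨i, _ | _⟩ := l
  · have h : (append x (FreeGroup.mk [(i, false)])).unop = (appendEdge x i).symm := by
      simp [append, FreeGroup.lift_mk]; rfl
    rw [h]
    refine VertexClass.ext_cast (by simp) ?_
    rw [letterPath, ← trans_cast]
    rfl
  · have h : (append x (FreeGroup.mk [(i, true)])).unop = (appendEdge x i) := by
      simp [append, FreeGroup.lift_mk]
    rw [h]
    refine VertexClass.ext_cast (by simp) ?_
    rw [letterPath, ← trans_cast]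
    rfl

/-- Acting with the class of a word appends the path spelled by this word, reduced or not. -/
theorem append_mk (x : Fin d → G) (L : List (Fin d × Bool)) (g : G)
    (p : Homotopic.Quotient (vertex x 1) (vertex x g)) :
    (append x (FreeGroup.mk L)).unop ⟨g, p⟩ =
      ⟨g * FreeGroup.lift x (FreeGroup.mk L), p.trans (.mk (wordPath x g L))⟩ := by
  induction L generalizing g with
  | nil =>
    refine (append_one x _).trans ?_
    refine VertexClass.ext_cast (by simp) ?_
    rw [wordPath, ← trans_cast]
    change p = p.trans (Homotopic.Quotient.refl _)
    simp
  | cons l L ih =>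
    have h : FreeGroup.mk (l :: L) = FreeGroup.mk [l] * FreeGroup.mk L := by simp
    refine ((congrArg (fun w => (append x w).unop _) h).trans (append_mul x _ _ _)).trans ?_
    rw [append_letter, ih]
    refine VertexClass.ext_cast (by simp [mul_assoc]) ?_
    rw [wordPath, ← trans_cast, Homotopic.Quotient.trans_assoc]
    rfl

/-- Acting on the constant path produces the path spelled by the reduced word. -/
theorem append_refl (x : Fin d → G) (w : FreeGroup (Fin d)) :
    (append x w).unop ⟨1, .refl _⟩ = ⟨FreeGroup.lift x w, .mk (gamma x w)⟩ := by
  conv_lhs => rw [← FreeGroup.mk_toWord (x := w)]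
  rw [append_mk]
  refine VertexClass.ext_cast (by simp [FreeGroup.mk_toWord]) ?_
  rw [gamma]
  simp
  rfl

/-- Appending edges commutes with prepending a loop. -/
theorem append_trans (x : Fin d → G) (w : FreeGroup (Fin d)) (g : G)
    (l : Homotopic.Quotient (vertex x 1) (vertex x 1))
    (p : Homotopic.Quotient (vertex x 1) (vertex x g)) :
    (append x w).unop ⟨g, l.trans p⟩ =
      ⟨((append x w).unop ⟨g, p⟩).1, l.trans ((append x w).unop ⟨g, p⟩).2⟩ := by
  rw [← FreeGroup.mk_toWord (x := w), append_mk, append_mk, Homotopic.Quotient.trans_assoc]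

theorem append_eq_gammaBar (x : Fin d → G) (a : (FreeGroup.lift x).ker) :
    (append x a).unop ⟨1, .refl _⟩ = ⟨1, toLoop (gammaBar x a)⟩ := by
  rw [append_refl]
  exact VertexClass.ext_cast ((FreeGroup.lift x).mem_ker.1 a.2) rfl

theorem append_loop (x : Fin d → G) (a : (FreeGroup.lift x).ker)
    (l : Homotopic.Quotient (vertex x 1) (vertex x 1)) :
    (append x a).unop ⟨1, l⟩ = ⟨1, l.trans (toLoop (gammaBar x a))⟩ := by
  have := append_trans x a 1 l (.refl _)
  rw [append_eq_gammaBar] at this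
  simpa using this

theorem gammaBar_mul (x : Fin d → G) (a b : (FreeGroup.lift x).ker) :
    gammaBar x (a * b) = gammaBar x a * gammaBar x b := by
  have h := append_eq_gammaBar x (a * b)
  rw [Subgroup.coe_mul, append_mul, append_eq_gammaBar, append_loop] at h
  exact congrArg (ofLoop x) (eq_of_heq (Sigma.mk.inj h).2).symm

/-- `gammaBar` as a group homomorphism. -/
def gammaHom (x : Fin d → G) : (FreeGroup.lift x).ker →* PiOne x :=
  MonoidHom.mk' (gammaBar x) (gammaBar_mul x)

/-- A label-preserving map of Cayley graphs maps spelled paths to spelled paths. This covers both the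
left translations and the projection from the Cayley graph of the free group. -/
theorem wordPath_map {H : Type*} [Group H] {x : Fin d → G} {y : Fin d → H}
    (f : Cal x → Cal y) (ψ : G → H) (hψ : ∀ g i, ψ (g * x i) = ψ g * y i)
    (hv : ∀ g, f (vertex x g) = vertex y (ψ g))
    (he : ∀ g i t, f (edge x g i t) = edge y (ψ g) i t) (L : List (Fin d × Bool)) (g : G)
    (t : unitInterval) : f (wordPath x g L t) = wordPath y (ψ g) L t := by
  have hψ' : ∀ g i, ψ (g * (x i)⁻¹) = ψ g * (y i)⁻¹ := fun g i => by
    rw [eq_mul_inv_iff_mul_eq, ← hψ, inv_mul_cancel_right]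
  have hl : ∀ g (l : Fin d × Bool) (t : unitInterval),
      f (letterPath x g l t) = letterPath y (ψ g) l t := by
    rintro g ⟨i, _ | _⟩ t
    · change f (edge x _ i _) = edge y _ i _
      rw [he, hψ']
    · exact he g i t
  have hw : ∀ g (l : Fin d × Bool), ψ (g * FreeGroup.lift x (FreeGroup.mk [l])) =
      ψ g * FreeGroup.lift y (FreeGroup.mk [l]) := by
    rintro g ⟨i, _ | _⟩
    · simpa using hψ' g i
    · simpa using hψ g i
  induction L generalizing g t with
  | nil => exact hv g
  | cons l L ih =>
    change f (((letterPath x g l).trans (wordPath x _ L)) t) =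
      ((letterPath y (ψ g) l).trans (wordPath y _ L)) t
    rw [Path.trans_apply, Path.trans_apply]
    split_ifs
    · exact hl ..
    · rw [ih, hw]

theorem shift_wordPath (x : Fin d → G) (h g : G) (L : List (Fin d × Bool)) (t : unitInterval) :
    shift x h (wordPath x g L t) = wordPath x (h * g) L t :=
  wordPath_map (shift x h) (h * ·) (fun _ _ => (mul_assoc _ _ _).symm) (fun _ => rfl)
    (fun _ _ _ => rfl) L g t

/-- Equivariance for a generator: the words `X_i * a` and `b * X_i` are equal in the free
group, so they spell the same class from the identity vertex, and the letters of
`a` read from the vertex `x i` spell the translate of the loop of `a`. -/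
theorem genLoop_gammaBar (x : Fin d → G) (i : Fin d) (a b : (FreeGroup.lift x).ker)
    (hb : (b : FreeGroup (Fin d)) = FreeGroup.of i * a * (FreeGroup.of i)⁻¹) :
    genLoop x i (toLoop (gammaBar x a)) = toLoop (gammaBar x b) := by
  have h : (append x a).unop ((append x (FreeGroup.of i)).unop ⟨1, .refl _⟩) =
      (append x (FreeGroup.of i)).unop ((append x b).unop ⟨1, .refl _⟩) := by
    rw [← append_mul, ← append_mul, hb, inv_mul_cancel_right]
  rw [append_eq_gammaBar, append_of, append_of] at h
  have hm : (append x a).unop ⟨1 * x i, (Homotopic.Quotient.refl _).trans (.mk (edge x 1 i))⟩ =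
      (append x (FreeGroup.mk (FreeGroup.toWord (a : FreeGroup (Fin d))))).unop
        ⟨1 * x i, (Homotopic.Quotient.refl _).trans (.mk (edge x 1 i))⟩ := by
    rw [FreeGroup.mk_toWord]
  have ha : FreeGroup.lift x (FreeGroup.mk (FreeGroup.toWord (a : FreeGroup (Fin d)))) = 1 := by
    rw [FreeGroup.mk_toWord]; exact (FreeGroup.lift x).mem_ker.1 a.2
  rw [hm, append_mk, Homotopic.Quotient.refl_trans] at h
  set e : Homotopic.Quotient (vertex x 1) (vertex x (x i)) :=
    .mk ((edge x 1 i).cast rfl (by rw [one_mul])) with he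
  set W := wordPath x (1 * x i) (FreeGroup.toWord (a : FreeGroup (Fin d))) with hW
  have hl : ((toLoop (gammaBar x a)).map (shift x (x i))).cast
      (by rw [shift_vertex, mul_one]) (by rw [shift_vertex, mul_one]) =
      (Homotopic.Quotient.mk W).cast (x' := vertex x (x i)) (y' := vertex x (x i))
        (by rw [one_mul]) (by rw [ha, one_mul, mul_one]) := by
    refine congrArg Homotopic.Quotient.mk (Path.ext (funext fun t => ?_))
    have := shift_wordPath x (x i) 1 (FreeGroup.toWord (a : FreeGroup (Fin d))) t
    rw [mul_one] at this
    exact this.trans (congrArg (fun h => wordPath x h _ t) (one_mul (x i)).symm)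
  change (e.trans (((toLoop (gammaBar x a)).map (shift x (x i))).cast _ _)).trans e.symm = _
  rw [hl]
  have h1 : (⟨x i, e.trans ((Homotopic.Quotient.mk W).cast (x' := vertex x (x i))
      (y' := vertex x (x i)) (by rw [one_mul]) (by rw [ha, one_mul, mul_one]))⟩ : VertexClass x) =
      ⟨x i, (toLoop (gammaBar x b)).trans e⟩ := by
    refine Eq.trans ?_ (h.trans ?_)
    · refine VertexClass.ext_cast (by rw [ha, one_mul, mul_one]) ?_
      rw [he, Homotopic.Quotient.mk_cast, cast_trans_cast]
    · refine (VertexClass.ext_cast (one_mul (x i)).symm ?_).symm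
      rw [he, Homotopic.Quotient.mk_cast, trans_cast]
  rw [eq_of_heq (Sigma.mk.inj h1).2]
  simp [Homotopic.Quotient.trans_assoc]

theorem gammaBar_conj (x : Fin d → G) (w : FreeGroup (Fin d)) (a : (FreeGroup.lift x).ker) :
    gammaBar x ⟨w * a * w⁻¹, (FreeGroup.lift x).normal_ker.conj_mem a a.2 w⟩ =
      action x w (gammaBar x a) := by
  induction w using FreeGroup.induction_on generalizing a with
  | C1 => simp
  | of i =>
    simp only [action, FreeGroup.lift_apply_of]
    exact congrArg (ofLoop x) (genLoop_gammaBar x i a _ rfl).symm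
  | inv_of i h =>
    rw [map_inv, MulAut.inv_def, MulEquiv.eq_symm_apply, ← h]
    congr 2
    simp [mul_assoc]
  | mul v w hv hw =>
    rw [map_mul, MulAut.mul_apply, ← hw, ← hv]
    congr 2
    simp [mul_assoc]

/-! ### Continuous functions on the Cayley graph -/

theorem isOpen_iff {x : Fin d → G} {U : Set (Cal x)} :
    IsOpen U ↔ ∀ g i, IsOpen (edge x g i ⁻¹' U) := by
  refine ⟨fun h g i => h.preimage (edge x g i).continuous, fun h => ?_⟩
  refine isOpen_coinduced.2 (isOpen_sum_iff.2 ⟨isOpen_sigma_iff.2 fun g => ?_,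
    isOpen_sigma_iff.2 fun e => h e.1 e.2⟩)
  exact isOpen_discrete _

theorem continuous_iff {x : Fin d → G} {Y : Type*} [TopologicalSpace Y] {f : Cal x → Y} :
    Continuous f ↔ ∀ g i, Continuous fun t => f (edge x g i t) :=
  ⟨fun h g i => h.comp (edge x g i).continuous, fun h => ⟨fun _ hU =>
    isOpen_iff.2 fun g i => hU.preimage (h g i)⟩⟩

/-- The function on the Cayley graph with the prescribed values `v` on the vertices and `e` on the
edges. -/
def desc {x : Fin d → G} {Y : Type*} (v : G → Y) (e : G → Fin d → unitInterval → Y)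
    (h₀ : ∀ g i, e g i 0 = v g) (h₁ : ∀ g i, e g i 1 = v (g * x i)) : Cal x → Y :=
  Quot.lift (Sum.elim (fun c => v c.1) fun c => e c.1.1 c.1.2 c.2) (by
    rintro _ _ (⟨g, i⟩ | ⟨g, i⟩)
    · exact h₀ g i
    · exact h₁ g i)

/-- Every point of the Cayley graph is a vertex or lies in the interior of an edge. -/
theorem vertex_or_edge {x : Fin d → G} (p : Cal x) : (∃ g, p = vertex x g) ∨
    ∃ g i, ∃ t : unitInterval, 0 < t ∧ t < 1 ∧ p = edge x g i t := by
  obtain ⟨(⟨g, _⟩ | ⟨⟨g, i⟩, t⟩)⟩ := p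
  · exact .inl ⟨g, rfl⟩
  · change (∃ g', edge x g i t = vertex x g') ∨ ∃ g' i', ∃ t' : unitInterval, 0 < t' ∧ t' < 1 ∧
      edge x g i t = edge x g' i' t'
    rcases eq_or_lt_of_le (unitInterval.nonneg' (t := t)) with h | h
    · exact .inl ⟨g, by rw [← h]; exact (edge x g i).source⟩
    rcases eq_or_lt_of_le (unitInterval.le_one' (t := t)) with h' | h'
    · exact .inl ⟨g * x i, by rw [h']; exact (edge x g i).target⟩
    · exact .inr ⟨g, i, t, h, h', rfl⟩

open Classical in
/-- The function `t ↦ c t` on the edge `(g, i)`, extended by zero. -/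
def edgeFun (x : Fin d → G) (g : G) (i : Fin d) (c : C(unitInterval, ℝ)) (h₀ : c 0 = 0)
    (h₁ : c 1 = 0) : Cal x → ℝ :=
  desc (fun _ => 0) (fun g' i' t => if g' = g ∧ i' = i then c t else 0)
    (fun _ _ => by simp [h₀]) (fun _ _ => by simp [h₁])

open Classical in
theorem edgeFun_edge (x : Fin d → G) (g : G) (i : Fin d) (c : C(unitInterval, ℝ)) (h₀ : c 0 = 0)
    (h₁ : c 1 = 0) (g' : G) (i' : Fin d) (t : unitInterval) :
    edgeFun x g i c h₀ h₁ (edge x g' i' t) = if g' = g ∧ i' = i then c t else 0 := rfl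

theorem continuous_edgeFun (x : Fin d → G) (g : G) (i : Fin d) (c : C(unitInterval, ℝ))
    (h₀ : c 0 = 0) (h₁ : c 1 = 0) : Continuous (edgeFun x g i c h₀ h₁) := by
  classical
  refine continuous_iff.2 fun g' i' => ?_
  simp_rw [edgeFun_edge]
  split_ifs
  · exact c.continuous
  · exact continuous_const

/-- The function that is `t * (1 - t)` on the edge `(g, i)` and zero elsewhere. -/
def bump (x : Fin d → G) (g : G) (i : Fin d) : Cal x → ℝ :=
  edgeFun x g i ⟨fun t => t * (1 - t), by fun_prop⟩ (by simp) (by simp)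

/-- The function that is `t * (t * (1 - t))` on the edge `(g, i)` and zero elsewhere. -/
def bumpMul (x : Fin d → G) (g : G) (i : Fin d) : Cal x → ℝ :=
  edgeFun x g i ⟨fun t => t * (t * (1 - t)), by fun_prop⟩ (by simp) (by simp)

/-- The interior of the edge `(g, i)`, encoded as the set where `bump` does not vanish, which makes
it visibly open. -/
def openEdge (x : Fin d → G) (g : G) (i : Fin d) : Set (Cal x) := {p | bump x g i p ≠ 0}

theorem isOpen_openEdge (x : Fin d → G) (g : G) (i : Fin d) : IsOpen (openEdge x g i) :=
  isOpen_ne_fun (continuous_edgeFun ..) continuous_const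

theorem edge_mem_openEdge {x : Fin d → G} {g g' : G} {i i' : Fin d} {t : unitInterval} :
    edge x g' i' t ∈ openEdge x g i ↔ (g' = g ∧ i' = i) ∧ 0 < t ∧ t < 1 := by
  classical
  change edgeFun _ _ _ _ _ _ _ ≠ 0 ↔ _
  rw [edgeFun_edge]
  have h0 : (t : ℝ) = 0 ↔ ¬ 0 < t := by
    rw [← unitInterval.coe_pos, not_lt]
    exact ⟨fun h => h.le, fun h => le_antisymm h t.2.1⟩
  have h1 : 1 - (t : ℝ) = 0 ↔ ¬ t < 1 := by
    rw [← unitInterval.coe_lt_one, not_lt, sub_eq_zero]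
    exact ⟨fun h => h.le, fun h => le_antisymm h t.2.2⟩
  split_ifs with h
  · simp only [ContinuousMap.coe_mk, ne_eq, mul_eq_zero, h0, h1]
    tauto
  · simp [h]

theorem vertex_notMem_openEdge (x : Fin d → G) (g g' : G) (i : Fin d) :
    vertex x g' ∉ openEdge x g i := fun h => h rfl

/-- The coordinate `t` of a point in the interior of the edge `(g, i)`, as a quotient of two continuous
functions on the Cayley graph; outside of this edge its value is irrelevant. -/
def coord (x : Fin d → G) (g : G) (i : Fin d) (p : Cal x) : unitInterval :=
  Set.projIcc 0 1 zero_le_one (bumpMul x g i p / bump x g i p)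

theorem continuousOn_coord (x : Fin d → G) (g : G) (i : Fin d) :
    ContinuousOn (coord x g i) (openEdge x g i) :=
  continuous_projIcc.comp_continuousOn ((continuous_edgeFun ..).continuousOn.div
    (continuous_edgeFun ..).continuousOn fun _ h => h)

theorem coord_edge (x : Fin d → G) (g : G) (i : Fin d) {t : unitInterval} (h₀ : 0 < t)
    (h₁ : t < 1) : coord x g i (edge x g i t) = t := by
  have h : bump x g i (edge x g i t) ≠ 0 := edge_mem_openEdge.2 ⟨⟨rfl, rfl⟩, h₀, h₁⟩
  have h' : bumpMul x g i (edge x g i t) = t * bump x g i (edge x g i t) := by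
    classical
    simp [bumpMul, bump, edgeFun_edge]
  rw [coord, h', mul_div_cancel_right₀ _ h, Set.projIcc_val]

theorem edge_coord {x : Fin d → G} {g : G} {i : Fin d} {p : Cal x} (h : p ∈ openEdge x g i) :
    edge x g i (coord x g i p) = p := by
  rcases vertex_or_edge p with ⟨g', rfl⟩ | ⟨g', i', t, h₀, h₁, rfl⟩
  · exact absurd h (vertex_notMem_openEdge _ _ _ _)
  · obtain ⟨⟨rfl, rfl⟩, -⟩ := edge_mem_openEdge.1 h
    rw [coord_edge x _ _ h₀ h₁]

theorem vertex_ne_edge {x : Fin d → G} {g g' : G} {i : Fin d} {t : unitInterval} (h₀ : 0 < t)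
    (h₁ : t < 1) : vertex x g ≠ edge x g' i t := fun h =>
  vertex_notMem_openEdge x g' g i (h ▸ edge_mem_openEdge.2 ⟨⟨rfl, rfl⟩, h₀, h₁⟩)

/-- An interior point of an edge has unique edge coordinates. -/
theorem edge_inj {x : Fin d → G} {g g' : G} {i i' : Fin d} {t t' : unitInterval} (h₀ : 0 < t)
    (h₁ : t < 1) (h : edge x g i t = edge x g' i' t') : g = g' ∧ i = i' ∧ t = t' := by
  have hm : edge x g' i' t' ∈ openEdge x g i := h ▸ edge_mem_openEdge.2 ⟨⟨rfl, rfl⟩, h₀, h₁⟩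
  obtain ⟨⟨rfl, rfl⟩, h₀', h₁'⟩ := edge_mem_openEdge.1 hm
  refine ⟨rfl, rfl, ?_⟩
  rw [← coord_edge x g' i' h₀ h₁, h, coord_edge x g' i' h₀' h₁']

open Classical in
/-- A function that is positive precisely on the points at distance less than `1 / 3` from the
vertex `g`. -/
def starFun (x : Fin d → G) (g : G) : Cal x → ℝ :=
  desc (fun g' => if g' = g then 1 else 0)
    (fun g' i t => (if g' = g then max 0 (1 - 3 * (t : ℝ)) else 0) +
      if g' * x i = g then max 0 (3 * (t : ℝ) - 2) else 0)
    (fun _ _ => by simp) (fun _ _ => by norm_num)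

/-- The open star of radius `1 / 3` around the vertex `g`. -/
def openStar (x : Fin d → G) (g : G) : Set (Cal x) := {p | 0 < starFun x g p}

theorem isOpen_openStar (x : Fin d → G) (g : G) : IsOpen (openStar x g) := by
  classical
  refine isOpen_lt continuous_const (continuous_iff.2 fun g' i => ?_)
  change Continuous fun t : unitInterval => (if g' = g then max 0 (1 - 3 * (t : ℝ)) else 0) +
      if g' * x i = g then max 0 (3 * (t : ℝ) - 2) else 0
  split_ifs <;> fun_prop

theorem vertex_mem_openStar {x : Fin d → G} {g g' : G} : vertex x g' ∈ openStar x g ↔ g' = g := by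
  classical
  change 0 < (if g' = g then (1 : ℝ) else 0) ↔ _
  split_ifs with h <;> simp [h]

theorem edge_mem_openStar {x : Fin d → G} {g g' : G} {i : Fin d} {t : unitInterval} :
    edge x g' i t ∈ openStar x g ↔
      (g' = g ∧ (t : ℝ) < 1 / 3) ∨ (g' * x i = g ∧ 2 / 3 < (t : ℝ)) := by
  classical
  change 0 < (if g' = g then max 0 (1 - 3 * (t : ℝ)) else 0) +
      (if g' * x i = g then max 0 (3 * (t : ℝ) - 2) else 0) ↔ _
  have h1 : 0 < max 0 (1 - 3 * (t : ℝ)) ↔ (t : ℝ) < 1 / 3 := by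
    rw [lt_max_iff]; constructor
    · rintro (h | h) <;> linarith
    · intro h; right; linarith
  have h2 : 0 < max 0 (3 * (t : ℝ) - 2) ↔ 2 / 3 < (t : ℝ) := by
    rw [lt_max_iff]; constructor
    · rintro (h | h) <;> linarith
    · intro h; right; linarith
  have h3 : ∀ {a b : ℝ}, 0 ≤ a → 0 ≤ b → (0 < a + b ↔ 0 < a ∨ 0 < b) := by
    intro a b ha hb
    constructor
    · intro h
      by_contra! h'
      linarith
    · rintro (h | h) <;> linarith
  have h4 : ∀ (q : Prop) (a : ℝ), 0 < (if q then a else 0) ↔ q ∧ 0 < a := by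
    intro q a
    split_ifs with h <;> simp [h]
  rw [h3 (by split_ifs <;> simp) (by split_ifs <;> simp), h4, h4, h1, h2]

theorem vertex_injective (x : Fin d → G) : Function.Injective (vertex x) := fun g g' h => by
  have : vertex x g ∈ openStar x g' := h ▸ vertex_mem_openStar.2 rfl
  exact vertex_mem_openStar.1 this

/-! ### The covering by the Cayley graph of the free group -/

/-- The action by left translations. -/
instance (x : Fin d → G) : MulAction G (Cal x) where
  smul h := shift x h
  one_smul := shift_one x
  mul_smul h k p := (shift_shift x h k p).symm

instance (x : Fin d → G) : ContinuousConstSMul G (Cal x) :=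
  ⟨fun h => (shift x h).continuous⟩

/-- Open stars of vertices and interiors of edges are disjoint from their nontrivial translates. -/
theorem exists_nhds_disjoint {x : Fin d → G} (p : Cal x) :
    ∃ U ∈ nhds p, ∀ h : G, ((h • ·) '' U ∩ U).Nonempty → h = 1 := by
  rcases vertex_or_edge p with ⟨g, rfl⟩ | ⟨g, i, t, h₀, h₁, rfl⟩
  · refine ⟨openStar x g, (isOpen_openStar x g).mem_nhds (vertex_mem_openStar.2 rfl), ?_⟩
    rintro h ⟨_, ⟨q, hq, rfl⟩, hq'⟩
    rcases vertex_or_edge q with ⟨g', rfl⟩ | ⟨g', i, t, -, -, rfl⟩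
    · have h1 := vertex_mem_openStar.1 hq
      have h2 := (vertex_mem_openStar (g' := h * g')).1 hq'
      rw [h1] at h2
      exact mul_eq_right.1 h2
    · have h1 := edge_mem_openStar.1 hq
      have h2 : edge x (h * g') i t ∈ openStar x g := hq'
      rw [edge_mem_openStar] at h2
      rcases h1 with ⟨h1, h3⟩ | ⟨h1, h3⟩ <;> rcases h2 with ⟨h2, h4⟩ | ⟨h2, h4⟩
      · exact mul_eq_right.1 (h2.trans h1.symm)
      · linarith
      · linarith
      · rw [mul_assoc, h1] at h2
        exact mul_eq_right.1 h2
  · refine ⟨openEdge x g i, (isOpen_openEdge x g i).mem_nhds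
      (edge_mem_openEdge.2 ⟨⟨rfl, rfl⟩, h₀, h₁⟩), ?_⟩
    rintro h ⟨_, ⟨q, hq, rfl⟩, hq'⟩
    rcases vertex_or_edge q with ⟨g', rfl⟩ | ⟨g', i', t', -, -, rfl⟩
    · exact absurd hq (vertex_notMem_openEdge _ _ _ _)
    · obtain ⟨⟨h1, -⟩, -⟩ := edge_mem_openEdge.1 hq
      obtain ⟨⟨h2, -⟩, -⟩ := (edge_mem_openEdge (g' := h * g')).1 hq'
      exact mul_eq_right.1 (h2.trans h1.symm)

/-- The projection from the Cayley graph of the free group to the Cayley graph of `G`, induced by the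
homomorphism from the free group to `G`. -/
def proj (x : Fin d → G) : Cal (FreeGroup.of : Fin d → FreeGroup (Fin d)) → Cal x :=
  desc (fun w => vertex x (FreeGroup.lift x w)) (fun w i t => edge x (FreeGroup.lift x w) i t)
    (fun _ _ => Path.source _) (fun w i => (Path.target _).trans (by simp))

theorem proj_vertex (x : Fin d → G) (w : FreeGroup (Fin d)) :
    proj x (vertex _ w) = vertex x (FreeGroup.lift x w) := rfl

theorem proj_edge (x : Fin d → G) (w : FreeGroup (Fin d)) (i : Fin d) (t : unitInterval) :
    proj x (edge _ w i t) = edge x (FreeGroup.lift x w) i t := rfl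

theorem continuous_proj (x : Fin d → G) : Continuous (proj x) :=
  continuous_iff.2 fun w i => (edge x (FreeGroup.lift x w) i).continuous

theorem lift_surjective {x : Fin d → G} (hx : Subgroup.closure (Set.range x) = ⊤) :
    Function.Surjective (FreeGroup.lift x) := by
  rw [← MonoidHom.range_eq_top, FreeGroup.range_lift_eq_closure, hx]

theorem isQuotientCoveringMap_proj {x : Fin d → G}
    (hx : Subgroup.closure (Set.range x) = ⊤) :
    IsQuotientCoveringMap (proj x) (FreeGroup.lift x).ker where
  surjective p := by
    rcases vertex_or_edge p with ⟨g, rfl⟩ | ⟨g, i, t, -, -, rfl⟩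
    · obtain ⟨w, rfl⟩ := lift_surjective hx g
      exact ⟨_, proj_vertex x w⟩
    · obtain ⟨w, rfl⟩ := lift_surjective hx g
      exact ⟨_, proj_edge x w i t⟩
  eq_coinduced := by
    refine TopologicalSpace.ext_iff.2 fun U => ⟨fun h => h.preimage (continuous_proj x), fun h => ?_⟩
    refine isOpen_iff.2 fun g i => ?_
    obtain ⟨w, rfl⟩ := lift_surjective hx g
    exact h.preimage (edge _ w i).continuous
  continuous_const_smul h := (shift _ (h : FreeGroup (Fin d))).continuous
  apply_eq_iff_mem_orbit {p q} := by
    -- elements of the free group with the same image in `G` differ by an element of the kernel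
    have key : ∀ {v w : FreeGroup (Fin d)}, FreeGroup.lift x v = FreeGroup.lift x w →
        ∃ n : (FreeGroup.lift x).ker, n * w = v := fun {v w} h =>
      ⟨⟨v * w⁻¹, by rw [MonoidHom.mem_ker, map_mul, map_inv, h, mul_inv_cancel]⟩, by simp⟩
    constructor
    · intro h
      rcases vertex_or_edge p with ⟨v, rfl⟩ | ⟨v, i, t, h₀, h₁, rfl⟩ <;>
        rcases vertex_or_edge q with ⟨w, rfl⟩ | ⟨w, j, s, h₀', h₁', rfl⟩
      · obtain ⟨n, hn⟩ := key (vertex_injective x h)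
        exact ⟨n, congrArg (vertex _) hn⟩
      · rw [proj_vertex, proj_edge] at h
        exact absurd h (vertex_ne_edge h₀' h₁')
      · rw [proj_vertex, proj_edge] at h
        exact absurd h.symm (vertex_ne_edge h₀ h₁)
      · rw [proj_edge, proj_edge] at h
        obtain ⟨hvw, rfl, rfl⟩ := edge_inj h₀ h₁ h
        obtain ⟨n, hn⟩ := key hvw
        exact ⟨n, congrArg (fun u => edge _ u i t) hn⟩
    · rintro ⟨n, rfl⟩
      have hn : ∀ w, FreeGroup.lift x (n * w) = FreeGroup.lift x w := fun w => by
        rw [map_mul, (FreeGroup.lift x).mem_ker.1 n.2, one_mul]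
      rcases vertex_or_edge q with ⟨w, rfl⟩ | ⟨w, j, s, -, -, rfl⟩
      · exact congrArg (vertex x) (hn w)
      · exact congrArg (fun g => edge x g j s) (hn w)
  disjoint p := by
    obtain ⟨U, hU, h⟩ := exists_nhds_disjoint p
    exact ⟨U, hU, fun n hn => Subtype.ext (h n hn)⟩

theorem proj_gamma (x : Fin d → G) (w : FreeGroup (Fin d)) (t : unitInterval) :
    proj x (gamma FreeGroup.of w t) = gamma x w t := by
  refine (wordPath_map (proj x) (FreeGroup.lift x) (by simp) (proj_vertex x) (proj_edge x)
    w.toWord 1 t).trans ?_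
  rw [map_one]
  rfl

/-- A path in the total space of a covering whose projection is null-homotopic is closed. -/
theorem _root_.IsCoveringMap.eq_of_homotopic_refl {E X : Type*} [TopologicalSpace E]
    [TopologicalSpace X] {p : E → X} (cov : IsCoveringMap p) {a b : E} {v : X} (Γ : Path a b)
    {γ : Path v v} (h : ∀ t, p (Γ t) = γ t) (hγ : γ.Homotopic (Path.refl v)) : a = b := by
  have hv : v = p a := by simpa using (h 0).symm
  have h1 := cov.liftPath_apply_one_eq_of_homotopicRel hγ a (γ.source.trans hv) hv
  rw [← (cov.eq_liftPath_iff' (Γ := Γ.toContinuousMap) _).2 ⟨funext h, Γ.source⟩] at h1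
  have h2 := congrArg (fun f : C(unitInterval, E) => f 1) (cov.liftPath_const hv)
  exact (h1.trans h2).symm.trans Γ.target

theorem gammaHom_injective {x : Fin d → G} (hx : Subgroup.closure (Set.range x) = ⊤) :
    Function.Injective (gammaHom x) := by
  refine (injective_iff_map_eq_one _).2 fun a ha => ?_
  have h1 : Homotopic.Quotient.mk ((gamma x a).cast rfl
      (by rw [(FreeGroup.lift x).mem_ker.1 a.2])) = .mk (Path.refl (vertex x 1)) :=
    MulOpposite.op_injective ha
  have h2 := (isQuotientCoveringMap_proj hx).isCoveringMap.eq_of_homotopic_refl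
    (gamma FreeGroup.of (a : FreeGroup (Fin d))) (proj_gamma x a) (Homotopic.Quotient.exact h1)
  have h3 := vertex_injective _ h2
  rw [FreeGroup.lift_of_eq_id, MonoidHom.id_apply] at h3
  exact Subtype.ext h3.symm

/-! ### Collapsing the stars -/

/-- The map of the interval that collapses `[0, 1 / 3]` and `[2 / 3, 1]` to the endpoints. -/
def clamp (t : unitInterval) : unitInterval := Set.projIcc 0 1 zero_le_one (3 * (t : ℝ) - 1)

theorem continuous_clamp : Continuous clamp := continuous_projIcc.comp (by fun_prop)

theorem clamp_of_le {t : unitInterval} (h : (t : ℝ) ≤ 1 / 3) : clamp t = 0 :=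
  Set.projIcc_of_le_left _ (by linarith)

theorem clamp_of_ge {t : unitInterval} (h : 2 / 3 ≤ (t : ℝ)) : clamp t = 1 :=
  Set.projIcc_of_right_le _ (by linarith)

theorem clamp_zero : clamp 0 = 0 := clamp_of_le (by norm_num)

theorem clamp_one : clamp 1 = 1 := clamp_of_ge (by norm_num)

/-- The deformation of the Cayley graph that stretches the middle third of every edge to the whole
edge. It maps a point to its track; in this curried form its continuity, jointly in the point and the
time, can be checked on each edge. -/
def stretch (x : Fin d → G) : Cal x → C(unitInterval, Cal x) :=
  desc (fun g => .const _ (vertex x g))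
    (fun g i t => ⟨fun s => edge x g i (Set.Icc.convexComb t (clamp t) s), by fun_prop⟩)
    (fun g i => by ext s; simp [clamp_zero])
    (fun g i => by ext s; simp [clamp_one])

theorem continuous_stretch (x : Fin d → G) : Continuous (stretch x) := by
  refine continuous_iff.2 fun g i => ContinuousMap.continuous_of_continuous_uncurry _ ?_
  refine (edge x g i).continuous.comp ?_
  have := continuous_clamp
  fun_prop

/-- The final map of the deformation `stretch`: it shrinks the star of radius `1 / 3` around a vertex
to this vertex. -/
def collapse (x : Fin d → G) (p : Cal x) : Cal x := stretch x p 1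

theorem continuous_collapse (x : Fin d → G) : Continuous (collapse x) :=
  (continuous_eval_const 1).comp (continuous_stretch x)

theorem collapse_edge (x : Fin d → G) (g : G) (i : Fin d) (t : unitInterval) :
    collapse x (edge x g i t) = edge x g i (clamp t) :=
  congrArg (edge x g i) (by simp)

theorem collapse_of_mem_openStar {x : Fin d → G} {g : G} {p : Cal x} (h : p ∈ openStar x g) :
    collapse x p = vertex x g := by
  rcases vertex_or_edge p with ⟨g', rfl⟩ | ⟨g', i, t, -, -, rfl⟩
  · rw [vertex_mem_openStar.1 h]; rfl
  · rw [collapse_edge]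
    rcases edge_mem_openStar.1 h with ⟨rfl, ht⟩ | ⟨rfl, ht⟩
    · rw [clamp_of_le ht.le, Path.source]
    · rw [clamp_of_ge ht.le, Path.target]

theorem stretch_zero (x : Fin d → G) (p : Cal x) : stretch x p 0 = p := by
  rcases vertex_or_edge p with ⟨g', rfl⟩ | ⟨g', i, t, -, -, rfl⟩
  · rfl
  · exact congrArg (edge x g' i) (by simp)

theorem homotopic_collapse {x : Fin d → G} {g h : G} (p : Path (vertex x g) (vertex x h)) :
    p.Homotopic (p.map (continuous_collapse x)) := by
  refine ⟨⟨⟨⟨fun st => stretch x (p st.2) st.1, ?_⟩, ?_, ?_⟩, ?_⟩⟩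
  · have := continuous_stretch x
    fun_prop
  · exact fun t => stretch_zero x (p t)
  · exact fun t => rfl
  · rintro s t (rfl | rfl)
    · change stretch x (p 0) s = p 0
      rw [p.source]; rfl
    · change stretch x (p 1) s = p 1
      rw [p.target]; rfl

/-! ### Segments of edges -/

instance : ContractibleSpace unitInterval :=
  (convex_Icc (0 : ℝ) 1).contractibleSpace ⟨0, by simp⟩

/-- The class of the paths from the point `s` to the point `t` inside the edge `(g, i)`; since the
interval is simply connected, it does not depend on the chosen path. -/
def seg (x : Fin d → G) (g : G) (i : Fin d) (s t : unitInterval) :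
    Homotopic.Quotient (edge x g i s) (edge x g i t) :=
  (Homotopic.Quotient.mk (PathConnectedSpace.somePath s t)).map (edge x g i).toContinuousMap

theorem mk_map_edge (x : Fin d → G) (g : G) (i : Fin d) {s t : unitInterval} (u : Path s t) :
    Homotopic.Quotient.mk (u.map (edge x g i).continuous) = seg x g i s t :=
  congrArg (fun q : Homotopic.Quotient s t => q.map (edge x g i).toContinuousMap)
    (Subsingleton.elim (Homotopic.Quotient.mk u) (.mk (PathConnectedSpace.somePath s t)))

theorem seg_self (x : Fin d → G) (g : G) (i : Fin d) (s : unitInterval) :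
    seg x g i s s = .refl _ :=
  (mk_map_edge x g i (Path.refl s)).symm

theorem seg_trans (x : Fin d → G) (g : G) (i : Fin d) (s t u : unitInterval) :
    (seg x g i s t).trans (seg x g i t u) = seg x g i s u := by
  rw [← mk_map_edge x g i (PathConnectedSpace.somePath s t),
    ← mk_map_edge x g i (PathConnectedSpace.somePath t u), ← Homotopic.Quotient.mk_trans,
    ← Path.map_trans, mk_map_edge]

theorem mk_edge (x : Fin d → G) (g : G) (i : Fin d) :
    Homotopic.Quotient.mk (edge x g i) =
      (seg x g i 0 1).cast (edge x g i).source.symm (edge x g i).target.symm := by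
  rw [← mk_map_edge x g i (⟨ContinuousMap.id _, rfl, rfl⟩ : Path (0 : unitInterval) 1)]
  rfl

/-! ### Spelled classes -/

/-- The class of a path from the identity vertex to a vertex is spelled if it is the class of a path
spelled by a word, which means that it lies in the orbit of the constant path. -/
def IsSpelled {x : Fin d → G} {g : G} (c : Homotopic.Quotient (vertex x 1) (vertex x g)) : Prop :=
  ∃ w : FreeGroup (Fin d), (append x w).unop ⟨1, .refl _⟩ = ⟨g, c⟩

theorem isSpelled_trans_edge {x : Fin d → G} {g : G} (i : Fin d)
    {c : Homotopic.Quotient (vertex x 1) (vertex x g)} :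
    IsSpelled (c.trans (.mk (edge x g i))) ↔ IsSpelled c := by
  constructor
  · rintro ⟨w, hw⟩
    refine ⟨w * (FreeGroup.of i)⁻¹, ?_⟩
    apply (append x (FreeGroup.of i)).unop.injective
    rw [← append_mul, inv_mul_cancel_right, append_of, hw]
  · rintro ⟨w, hw⟩
    exact ⟨w * FreeGroup.of i, by rw [append_mul, hw, append_of]⟩

/-- The class of a path from the identity vertex to an arbitrary point is tame if it is spelled (when
the point is a vertex), or becomes spelled by going back to the start of the edge (when the point is
in the interior of an edge). -/
def IsTame {x : Fin d → G} {a : Cal x} (c : Homotopic.Quotient (vertex x 1) a) : Prop :=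
  (∀ g (h : vertex x g = a), IsSpelled (c.cast rfl h)) ∧
    ∀ g i t (h : edge x g i t = a), 0 < t → t < 1 →
      IsSpelled (((c.cast rfl h).trans (seg x g i t 0)).cast rfl (edge x g i).source.symm)

theorem isTame_vertex {x : Fin d → G} {g : G}
    {c : Homotopic.Quotient (vertex x 1) (vertex x g)} : IsTame c ↔ IsSpelled c := by
  constructor
  · intro h
    simpa using h.1 g rfl
  · refine fun h => ⟨fun g' hg => ?_, fun g' i t ht h₀ h₁ => absurd ht.symm (vertex_ne_edge h₀ h₁)⟩
    obtain rfl := vertex_injective x hg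
    simpa using h

theorem isTame_cast {x : Fin d → G} {a b : Cal x} {c : Homotopic.Quotient (vertex x 1) a}
    (h : b = a) : IsTame (c.cast rfl h) ↔ IsTame c := by
  subst h
  simp

/-- At a point of an edge, including its ends, tameness can be tested by going back to the start of
this edge. In this form the condition does not depend on the edge segment passed last. -/
theorem isTame_edge {x : Fin d → G} {g : G} {i : Fin d} {s : unitInterval}
    {c : Homotopic.Quotient (vertex x 1) (edge x g i s)} :
    IsTame c ↔
      IsSpelled ((c.trans (seg x g i s 0)).cast rfl (edge x g i).source.symm) := by
  rcases eq_or_lt_of_le (unitInterval.nonneg' (t := s)) with rfl | h₀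
  · rw [← isTame_cast (edge x g i).source.symm, isTame_vertex, seg_self,
      Homotopic.Quotient.trans_refl]
  rcases eq_or_lt_of_le (unitInterval.le_one' (t := s)) with rfl | h₁
  · rw [← isTame_cast (edge x g i).target.symm, isTame_vertex, ← isSpelled_trans_edge (g := g) i,
      mk_edge, cast_trans_cast, Homotopic.Quotient.trans_assoc, seg_trans, seg_self,
      Homotopic.Quotient.trans_refl]
  · constructor
    · intro h
      simpa using h.2 g i s rfl h₀ h₁
    · refine fun h => ⟨fun g' hg => absurd hg (vertex_ne_edge h₀ h₁), fun g' i' t ht h₀' h₁' => ?_⟩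
      obtain ⟨rfl, rfl, rfl⟩ := edge_inj h₀' h₁' ht
      simpa using h

theorem IsTame.trans_of_const {x : Fin d → G} {a b v : Cal x}
    {c : Homotopic.Quotient (vertex x 1) a} (hc : IsTame c) {q : Path a b} (hq : ∀ t, q t = v) :
    IsTame (c.trans (.mk q)) := by
  obtain rfl : a = v := by rw [← hq 0, q.source]
  obtain rfl : b = a := by rw [← hq 1, q.target]
  have : q = Path.refl b := Path.ext (funext hq)
  rw [this, Homotopic.Quotient.mk_refl, Homotopic.Quotient.trans_refl]
  exact hc

theorem IsTame.trans_of_edge {x : Fin d → G} {a b : Cal x} {g : G} {i : Fin d}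
    {c : Homotopic.Quotient (vertex x 1) a} (hc : IsTame c) {q : Path a b}
    (u : C(unitInterval, unitInterval)) (hq : ∀ t, q t = edge x g i (u t)) :
    IsTame (c.trans (.mk q)) := by
  obtain rfl : a = edge x g i (u 0) := by rw [← hq 0, q.source]
  obtain rfl : b = edge x g i (u 1) := by rw [← hq 1, q.target]
  have : q = (⟨u, rfl, rfl⟩ : Path (u 0) (u 1)).map (edge x g i).continuous :=
    Path.ext (funext hq)
  rw [this, mk_map_edge, isTame_edge, Homotopic.Quotient.trans_assoc, seg_trans, ← isTame_edge]
  exact hc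

theorem exists_mem_openStar_or_openEdge {x : Fin d → G} (p : Cal x) :
    (∃ g, p ∈ openStar x g) ∨ ∃ g i, p ∈ openEdge x g i := by
  rcases vertex_or_edge p with ⟨g, rfl⟩ | ⟨g, i, t, h₀, h₁, rfl⟩
  · exact .inl ⟨g, vertex_mem_openStar.2 rfl⟩
  · exact .inr ⟨g, i, edge_mem_openEdge.2 ⟨⟨rfl, rfl⟩, h₀, h₁⟩⟩

/-- Appending the collapse of a piece of a path that lies in one open star or in the interior of one
edge preserves tameness. -/
theorem IsTame.trans_subpath {x : Fin d → G} {a b : Cal x} (p : Path a b) {s t : unitInterval}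
    (hst : s ≤ t) {U : Set (Cal x)} (hU : Set.Icc s t ⊆ p ⁻¹' U)
    (h : (∃ g, U = openStar x g) ∨ ∃ g i, U = openEdge x g i)
    {c : Homotopic.Quotient (vertex x 1) (p.map (continuous_collapse x) s)} (hc : IsTame c) :
    IsTame (c.trans (.mk ((p.map (continuous_collapse x)).subpath s t))) := by
  have hmem : ∀ r, p.subpath s t r ∈ U := by
    intro r
    have : p.subpath s t r ∈ Set.range (p.subpath s t) := ⟨r, rfl⟩
    rw [p.range_subpath_of_le s t hst] at this
    obtain ⟨r', hr', h⟩ := this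
    exact h ▸ hU hr'
  rcases h with ⟨g, rfl⟩ | ⟨g, i, rfl⟩
  · exact hc.trans_of_const fun r => collapse_of_mem_openStar (hmem r)
  · refine hc.trans_of_edge (g := g) (i := i) ⟨fun r => clamp (coord x g i (p.subpath s t r)),
      continuous_clamp.comp
        ((continuousOn_coord x g i).comp_continuous (p.subpath s t).continuous hmem)⟩ fun r => ?_
    exact (congrArg (collapse x) (edge_coord (hmem r)).symm).trans (collapse_edge ..)

/-- A path is tame if appending the pieces of a subdivision preserves tameness. -/
theorem isTame_of_subdivision {x : Fin d → G} {b : Cal x} (r : Path (vertex x 1) b)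
    {t : ℕ → unitInterval} (t_zero : t 0 = 0) {n : ℕ} (hn : t n = 1)
    (step : ∀ (n : ℕ) (c : Homotopic.Quotient (vertex x 1) (r (t n))), IsTame c →
      IsTame (c.trans (.mk (r.subpath (t n) (t (n + 1)))))) :
    IsTame (Homotopic.Quotient.mk r) := by
  have key : ∀ n, IsTame ((Homotopic.Quotient.mk (r.subpath 0 (t n))).cast
      r.source.symm rfl) := by
    intro n
    induction n with
    | zero =>
      rw [t_zero, Path.subpath_self, ← isTame_cast r.source.symm, Homotopic.Quotient.cast_cast]
      refine isTame_vertex.2 ⟨1, ?_⟩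
      rw [append_one]
      refine VertexClass.ext_cast rfl ?_
      exact congrArg Homotopic.Quotient.mk (Path.ext (funext fun _ => r.source.symm))
    | succ n ih =>
      have h := step n _ ih
      have h' : Homotopic.Quotient.mk (r.subpath 0 (t (n + 1))) =
          (Homotopic.Quotient.mk (r.subpath 0 (t n))).trans
            (.mk (r.subpath (t n) (t (n + 1)))) := by
        rw [← Homotopic.Quotient.mk_trans]
        exact (Homotopic.Quotient.eq.2 ⟨Path.Homotopy.subpathTransSubpath r _ _ _⟩).symm
      rw [h']
      exact h
  have h := key n
  rw [hn, ← isTame_cast r.target.symm, Homotopic.Quotient.cast_cast, Path.subpath_zero_one] at h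
  exact h

theorem isTame_collapse {x : Fin d → G} {b : Cal x} (p : Path (vertex x 1) b) :
    IsTame (x := x) (.mk (p.map (continuous_collapse x))) := by
  let U : G ⊕ G × Fin d → Set (Cal x) := Sum.elim (openStar x) fun e => openEdge x e.1 e.2
  obtain ⟨t, t_zero, t_mono, ⟨n, hn⟩, ht⟩ :=
    exists_monotone_Icc_subset_open_cover_unitInterval (c := fun e => p ⁻¹' U e)
      (fun e => IsOpen.preimage p.continuous (by
        rcases e with g | e
        exacts [isOpen_openStar x g, isOpen_openEdge x e.1 e.2])) (fun s _ => by
      rcases exists_mem_openStar_or_openEdge (p s) with ⟨g, h⟩ | ⟨g, i, h⟩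
      exacts [Set.mem_iUnion.2 ⟨.inl g, h⟩, Set.mem_iUnion.2 ⟨.inr (g, i), h⟩])
  refine isTame_of_subdivision (x := x) (p.map (continuous_collapse x)) t_zero (hn n le_rfl)
    fun n c hc => ?_
  obtain ⟨e, he⟩ := ht n
  refine IsTame.trans_subpath p (t_mono n.le_succ) he ?_ hc
  rcases e with g | ⟨g, i⟩
  exacts [.inl ⟨g, rfl⟩, .inr ⟨g, i, rfl⟩]

theorem gammaHom_surjective (x : Fin d → G) : Function.Surjective (gammaHom x) := by
  intro c
  obtain ⟨p, hp⟩ := Homotopic.Quotient.mk_surjective (toLoop c)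
  have h : IsSpelled (Homotopic.Quotient.mk p) := by
    rw [Homotopic.Quotient.eq.2 (homotopic_collapse p)]
    exact isTame_vertex.1 (isTame_collapse p)
  obtain ⟨w, hw⟩ := h
  have hw1 : FreeGroup.lift x w = 1 := by
    rw [append_refl] at hw
    exact congrArg Sigma.fst hw
  refine ⟨⟨w, hw1⟩, ?_⟩
  have h2 := append_eq_gammaBar x ⟨w, hw1⟩
  rw [hw, hp] at h2
  exact congrArg (ofLoop x) (eq_of_heq (Sigma.mk.inj h2).2).symm

end CayleyComplex

end

theorem theorem1 {G : Type*} [Group G] {d : ℕ} (x : Fin d → G)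
    (hx : Subgroup.closure (Set.range x) = ⊤) :
    (∃ Φ : (FreeGroup.lift x).ker ≃* CayleyComplex.PiOne x,
      ∀ a : (FreeGroup.lift x).ker, Φ a = CayleyComplex.gammaBar x a) ∧
    ∀ (w : FreeGroup (Fin d)) (a : (FreeGroup.lift x).ker),
      CayleyComplex.gammaBar x
          ⟨w * a * w⁻¹, (FreeGroup.lift x).normal_ker.conj_mem a a.2 w⟩ =
        CayleyComplex.action x w (CayleyComplex.gammaBar x a) :=
  ⟨⟨MulEquiv.ofBijective (CayleyComplex.gammaHom x)
      ⟨CayleyComplex.gammaHom_injective hx, CayleyComplex.gammaHom_surjective x⟩, fun _ => rfl⟩,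
    CayleyComplex.gammaBar_conj x⟩
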